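/- Let $N\in\mathbb N$, let $f_1,\dots,f_N\colon[0,1]\to[0,1]$ and $g_1,\dots,g_N\colon[0,1]\to\mathbb R$ be Lebesgue measurable functions, and let $\|\cdot\|$ be the norm of $L^1([0,1])$. A number $l$ is the approximate derivative $h'(x_0)$ of $h\colon[0,1]\to\mathbb R$ at $x_0$ if for every $\varepsilon>0$ the set $\{x\in[0,1]\setminus\{x_0\}:|h(x)-h(x_0)-l(x-x_0)|<\varepsilon|x-x_0|\}$ has $x_0$ as a Lebesgue density point; where no such $l$ exists, put $h'(x_0)=0$. Assume: (H1) each $f_n$ is approximately differentiable almost everywhere and maps sets of measure zero to sets of measure zero (Luzin's condition N); (H2) $K\geq 1$ is an integer such that for every $n$ the set $\{y\in[0,1]:\operatorname{card} f_n^{-1}(y)>K\}$ has measure zero; (H3) for every $n$ and every $A\subset\mathbb R$ of measure zero the set $f_n^{-1}(A)$ has measure zero. Let $L$ be the largest $m\in\{1,\dots,N\}$ for which there are $n_1<\dots<n_m$ such that $f_{n_1}([0,1])\cap\dots\cap f_{n_m}([0,1])$ has positive measure, and assume that $$|g_n(x)|<\frac{1}{KL}|f_n'(x)|\quad\text{for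 all }n\in\{1,\dots,N\}\text{ and almost all }x\in[0,1].$$ Then $Ph=\sum_{n=1}^N g_n\cdot(h\circ f_n)$ defines a continuous linear operator $P\colon L^1([0,1])\to L^1([0,1])$, and the following holds. Let $g\in L^1([0,1])$ satisfy $\|P^kg\|>0$ for every integer $k\ge1$, and suppose that there are $m\in\{1,\dots,N\}$ and a real $C<1$ such that $$|g_m(x)|\leq\frac{C}{KL}|f_m'(x)|\quad\text{for almost all }x\in[0,1]$$ and $$\inf_{k\geq1}\frac{1}{\|P^kg\|}\int_{f_m([0,1])}|P^kg(x)|\,dx>0.$$ Then there is $\alpha\in(0,1)$ with $\|P^kg\|\leq\alpha^k\|g\|$ for all $k\geq0$, and the elementary solution of $\varphi=P\varphi+g$ exists, that is, the series $\sum_{k=0}^\infty P^kg$ converges in $L^1([0,1])$. -/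

import Mathlib

open MeasureTheory Set Filter Topology
open scoped unitInterval ENNReal

/-- `x` is a (Lebesgue) density point of `S ⊆ ℝ`. -/
def IsDensityPoint (S : Set ℝ) (x : ℝ) : Prop :=
  Tendsto (fun r : ℝ => volume (S ∩ Metric.closedBall x r) / volume (Metric.closedBall x r))
    (𝓝[>] 0) (𝓝 1)

/-- The linear map `t ↦ l * t` is an approximate differential at `x₀ ∈ E` of `h : E → ℝ`. -/
def HasApproxDerivAt {E : Set ℝ} (h : E → ℝ) (l : ℝ) (x₀ : E) : Prop :=
  ∀ ε : ℝ, 0 < ε →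
    IsDensityPoint
      (Subtype.val '' {x : E | x ≠ x₀ ∧
        |h x - h x₀ - l * ((x : ℝ) - (x₀ : ℝ))| / |(x : ℝ) - (x₀ : ℝ)| < ε})
      (x₀ : ℝ)

/-- `h` is approximately differentiable at `x₀`. -/
def ApproxDifferentiableAt {E : Set ℝ} (h : E → ℝ) (x₀ : E) : Prop :=
  ∃ l : ℝ, HasApproxDerivAt h l x₀

open Classical in
/-- The approximate derivative, with value `0` where `h` is not approximately differentiable. -/
noncomputable def approxDeriv {E : Set ℝ} (h : E → ℝ) (x₀ : E) : ℝ :=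
  if hd : ApproxDifferentiableAt h x₀ then hd.choose else 0

/-- Luzin's condition N for a self-map of `[0,1]`: null sets are mapped to null sets. -/
def LuzinN (f : I → I) : Prop :=
  ∀ A : Set I, volume A = 0 → volume (f '' A) = 0

/-- The largest number `m` of distinct indices `n₁, …, n_m` for which
`f_{n₁}([0,1]) ∩ ⋯ ∩ f_{n_m}([0,1])` has positive measure. -/
noncomputable def overlapNumber {N : ℕ} (f : Fin N → I → I) : ℕ :=
  sSup {m : ℕ | ∃ S : Finset (Fin N), S.Nonempty ∧ S.card = m ∧
    0 < volume (⋂ n ∈ S, range (f n))}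

/-- The real Banach space `L¹([0,1])`. -/
abbrev L1I : Type := Lp ℝ 1 (volume : Measure I)

/-- `φ₀` is the elementary solution of `φ = P φ + u`, that is, the series `∑ Pᵏ u` converges
to `φ₀` in `L¹([0,1])`. -/
def IsElementarySolution (P : L1I →L[ℝ] L1I) (u φ₀ : L1I) : Prop :=
  Tendsto (fun M : ℕ => ∑ k ∈ Finset.range M, (P ^ k) u) atTop (𝓝 φ₀)

/-! Everything rests on the area inequality `∫ |f'| (w ∘ f) ≤ K ∫_{range f} w`
(`lintegral_abs_mul_comp_le`). Up to a null set, a map with nonzero approximate derivative splits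
into countably many disjoint pieces on which it agrees with a Lipschitz function, is differentiable
and injective. Change of variables holds on each piece, and a.e. point lies in the images of at most
`K` pieces. Condition N makes the range measurable up to a null set.

The bound on `g_n` then gives `∫ |g_n (h ∘ f_n)| ≤ (1/L) ∫_{range f_n} |h|`. Since a.e. point lies
in at most `L` ranges, summing over `n` shows that `P` is a contraction. Two refinements give decay.
If `P h ≠ 0`, then `‖P h‖ < ‖h‖`, because equality would force every term of `P h` to vanish. The
better constant `C` for `f_m` saves `(1 - C)/L ∫_{range f_m} |h|`; for `h = P^k u` with `k ≥ 1` this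
is at least a fixed fraction of `‖P^k u‖`. The first covers the step from `k = 0`, the second all
later ones, and a geometric series finishes the proof. -/

/-! ### Approximate derivatives and density points -/

/-- `l` is an approximate derivative at `x` of `φ` relative to the set `A` of the real line. -/
def HasApproxDerivWithinAt (φ : ℝ → ℝ) (l : ℝ) (A : Set ℝ) (x : ℝ) : Prop :=
  ∀ ε : ℝ, 0 < ε → IsDensityPoint
    {y | y ∈ A ∧ y ≠ x ∧ |φ y - φ x - l * (y - x)| / |y - x| < ε} x

theorem IsDensityPoint.eventually_lt {S : Set ℝ} {x : ℝ} (h : IsDensityPoint S x)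
    {c : ℝ≥0∞} (hc : c < 1) :
    ∀ᶠ r : ℝ in 𝓝[>] 0, c * volume (Metric.closedBall x r) <
      volume (S ∩ Metric.closedBall x r) := by
  filter_upwards [h.eventually (lt_mem_nhds hc), self_mem_nhdsWithin] with r hr hr0
  have hr0 : 0 < r := hr0
  rwa [ENNReal.lt_div_iff_mul_lt] at hr
  · left; simp [Real.volume_closedBall, hr0]
  · left; simp [Real.volume_closedBall, ENNReal.mul_eq_top]

theorem inter_nonempty_of_measure_lt_add_of_nullMeasurableSet {α : Type*} [MeasurableSpace α]
    {μ : Measure α} {s t u : Set α} (ht : NullMeasurableSet t μ) (hs : s ⊆ u) (htu : t ⊆ u)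
    (h : μ u < μ s + μ t) : (s ∩ t).Nonempty := by
  obtain ⟨t', ht't, ht'm, ht'e⟩ := ht.exists_measurable_subset_ae_eq
  refine (nonempty_inter_of_measure_lt_add μ ht'm hs (ht't.trans htu) ?_).mono
    (inter_subset_inter_right _ ht't)
  rwa [measure_congr ht'e]

/-- In a small ball each set has more than 3/4 of the measure, so they must meet. Additivity needs
only one of them to be measurable. -/
theorem IsDensityPoint.exists_mem_inter {S T : Set ℝ} {x : ℝ} (hS : IsDensityPoint S x)
    (hT : IsDensityPoint T x) (hTm : MeasurableSet T) {δ : ℝ} (hδ : 0 < δ) :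
    ∃ y ∈ S ∩ T, |y - x| < δ := by
  have hc : (3 / 4 : ℝ≥0∞) < 1 := by
    rw [ENNReal.div_lt_iff] <;> norm_num
  have hsmall : ∀ᶠ r : ℝ in 𝓝[>] 0, r < δ := mem_nhdsWithin_of_mem_nhds (Iio_mem_nhds hδ)
  obtain ⟨r, hr1, hr2, hr3, hr0⟩ := ((hS.eventually_lt hc).and ((hT.eventually_lt hc).and
    (hsmall.and self_mem_nhdsWithin))).exists
  have hr0 : 0 < r := hr0
  obtain ⟨y, hyS, hyT⟩ := nonempty_inter_of_measure_lt_add volume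
    (hTm.inter Metric.isClosed_closedBall.measurableSet) (u := Metric.closedBall x r)
    inter_subset_right inter_subset_right (by
      refine lt_of_le_of_lt ?_ (ENNReal.add_lt_add hr1 hr2)
      rw [← add_mul]
      refine le_mul_of_one_le_left (by positivity) ?_
      rw [← ENNReal.add_div, ENNReal.le_div_iff_mul_le] <;> norm_num)
  refine ⟨y, ⟨hyS.1, hyT.1⟩, lt_of_le_of_lt ?_ hr3⟩
  simpa [Real.dist_eq] using hyS.2

/-- At a density point of the coincidence set with a differentiable function, the approximate
derivative is the derivative. -/
theorem HasApproxDerivWithinAt.eq_of_hasDerivAt {φ F : ℝ → ℝ} {l d x : ℝ} {A T : Set ℝ}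
    (hφ : HasApproxDerivWithinAt φ l A x) (hF : HasDerivAt F d x) (hT : IsDensityPoint T x)
    (hTm : MeasurableSet T) (heq : EqOn φ F T) (hx : x ∈ T) : l = d := by
  have key : ∀ ε : ℝ, 0 < ε → |l - d| ≤ ε := by
    intro ε hε
    have h1 := hφ (ε / 2) (half_pos hε)
    have h2 : ∀ᶠ y in 𝓝 x, |F y - F x - d * (y - x)| ≤ ε / 2 * |y - x| := by
      have := (hasDerivAt_iff_isLittleO.1 hF).bound (half_pos hε)
      filter_upwards [this] with y hy
      simpa [mul_comm] using hy
    obtain ⟨δ, hδ, h3⟩ := Metric.eventually_nhds_iff.1 h2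
    obtain ⟨y, ⟨⟨-, hyx, hy1⟩, hyT⟩, hy2⟩ := h1.exists_mem_inter hT hTm hδ
    have h4 := h3 (y := y) (by simpa [Real.dist_eq] using hy2)
    have hpos : 0 < |y - x| := abs_pos.2 (sub_ne_zero.2 hyx)
    rw [div_lt_iff₀ hpos, heq hyT, heq hx] at hy1
    have : |l - d| * |y - x| ≤ ε * |y - x| := by
      rw [← abs_mul]
      calc |(l - d) * (y - x)| = |(F y - F x - d * (y - x)) - (F y - F x - l * (y - x))| := by
            congr 1; ring
        _ ≤ |F y - F x - d * (y - x)| + |F y - F x - l * (y - x)| := abs_sub _ _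
        _ ≤ ε * |y - x| := by linarith
    exact le_of_mul_le_mul_right this hpos
  have : |l - d| ≤ 0 := le_of_forall_pos_le_add (by simpa using key)
  exact sub_eq_zero.1 (abs_nonpos_iff.1 this)

/-! ### Decomposition into injective differentiable pieces -/

/-- Points near which `φ` grows with slope at most `n + 1` on a large proportion of `A`, at all
scales below `1 / (n + 1)`. -/
def slopeSet (φ : ℝ → ℝ) (A : Set ℝ) (n : ℕ) : Set ℝ :=
  {x | ∀ r : ℝ, 0 < r → r < 1 / ((n : ℝ) + 1) →
    3 / 4 * volume (Metric.closedBall x r) <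
      volume ({y | y ∈ A ∧ |φ y - φ x| ≤ (n + 1) * |y - x|} ∩ Metric.closedBall x r)}

theorem HasApproxDerivWithinAt.exists_mem_slopeSet {φ : ℝ → ℝ} {l x : ℝ} {A : Set ℝ}
    (h : HasApproxDerivWithinAt φ l A x) : ∃ n, x ∈ slopeSet φ A n := by
  have hc : (3 / 4 : ℝ≥0∞) < 1 := by
    rw [ENNReal.div_lt_iff] <;> norm_num
  have h1 := (h 1 one_pos).eventually_lt hc
  obtain ⟨δ, hδ, h2⟩ := mem_nhdsGT_iff_exists_Ioo_subset.1 h1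
  have hδ : 0 < δ := hδ
  -- With `ε = 1` the slope is at most `1 + |l|`; one index has to control both the scale `δ` and
  -- this slope.
  obtain ⟨n₁, hn₁⟩ := exists_nat_one_div_lt hδ
  obtain ⟨n₂, hn₂⟩ := exists_nat_ge |l|
  refine ⟨max n₁ n₂, fun r hr0 hr => ?_⟩
  have hle : (1 : ℝ) / (((max n₁ n₂ : ℕ) : ℝ) + 1) ≤ 1 / ((n₁ : ℝ) + 1) := by
    apply one_div_le_one_div_of_le (by positivity)
    gcongr; exact le_max_left _ _
  have h3 := h2 ⟨hr0, hr.trans (hle.trans_lt hn₁)⟩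
  refine lt_of_lt_of_le h3 (measure_mono ?_)
  rintro y ⟨⟨hyA, hyx, hy⟩, hyr⟩
  refine ⟨⟨hyA, ?_⟩, hyr⟩
  have hpos : 0 < |y - x| := abs_pos.2 (sub_ne_zero.2 hyx)
  rw [div_lt_iff₀ hpos, one_mul] at hy
  have hl : |l| ≤ ((max n₁ n₂ : ℕ) : ℝ) := hn₂.trans (by exact_mod_cast le_max_right _ _)
  calc |φ y - φ x| = |(φ y - φ x - l * (y - x)) + l * (y - x)| := by congr 1; ring
    _ ≤ |φ y - φ x - l * (y - x)| + |l * (y - x)| := abs_add_le _ _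
    _ ≤ |y - x| + |l| * |y - x| := by rw [abs_mul]; gcongr
    _ ≤ |y - x| + ((max n₁ n₂ : ℕ) : ℝ) * |y - x| := by gcongr
    _ = _ := by ring

/-- At scale `r = x' - x` the good sets of the two points share some `y`, and `φ x`, `φ x'` are
compared through `φ y`. -/
theorem dist_le_of_mem_slopeSet {φ : ℝ → ℝ} {A : Set ℝ} (hA : MeasurableSet A)
    (hφ : AEMeasurable φ (volume.restrict A)) {n : ℕ} {x x' : ℝ} (hx : x ∈ slopeSet φ A n)
    (hx' : x' ∈ slopeSet φ A n) (hlt : x < x') (hd : x' - x < 1 / ((n : ℝ) + 1)) :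
    |φ x - φ x'| ≤ 2 * (n + 1) * |x - x'| := by
  set r := x' - x with hr
  have hr0 : 0 < r := sub_pos.2 hlt
  have h1 := hx r hr0 hd
  have h2 := hx' r hr0 hd
  have hnull : ∀ z, NullMeasurableSet {y | y ∈ A ∧ |φ y - φ z| ≤ (n + 1) * |y - z|} volume := by
    intro z
    have h3 : NullMeasurableSet {y | |φ y - φ z| ≤ (n + 1) * |y - z|} (volume.restrict A) := by
      refine nullMeasurableSet_le ?_ ?_
      · exact (hφ.sub_const _).abs
      · exact Measurable.aemeasurable (by fun_prop)
    have := (nullMeasurableSet_restrict hA.nullMeasurableSet).1 h3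
    rwa [inter_comm] at this
  have hsub : ∀ z, Metric.closedBall z r = Icc (z - r) (z + r) := fun z => Real.closedBall_eq_Icc
  obtain ⟨y, ⟨⟨-, hy1⟩, hy2⟩, ⟨-, hy3⟩, hy4⟩ :=
    inter_nonempty_of_measure_lt_add_of_nullMeasurableSet
      (u := Icc (x - r) (x' + r)) (μ := volume)
      (s := {y | y ∈ A ∧ |φ y - φ x| ≤ (n + 1) * |y - x|} ∩ Metric.closedBall x r)
      (t := {y | y ∈ A ∧ |φ y - φ x'| ≤ (n + 1) * |y - x'|} ∩ Metric.closedBall x' r)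
      ((hnull x').inter Metric.isClosed_closedBall.measurableSet.nullMeasurableSet)
      (inter_subset_right.trans (by rw [hsub]; exact Icc_subset_Icc le_rfl (by linarith)))
      (inter_subset_right.trans (by rw [hsub]; exact Icc_subset_Icc (by linarith) le_rfl)) (by
        -- Both balls lie in an interval of length `3r`, and each good set has measure above `3/4 ·
        -- 2r`. This is where the constant 3/4 comes from.
        refine lt_of_eq_of_lt ?_ (ENNReal.add_lt_add h1 h2)
        have h34 : (3 / 4 : ℝ≥0∞) = ENNReal.ofReal (3 / 4) := by
          rw [ENNReal.ofReal_div_of_pos (by norm_num)]; norm_num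
        rw [Real.volume_closedBall, Real.volume_closedBall, Real.volume_Icc, h34,
          ← ENNReal.ofReal_mul (by norm_num), ← ENNReal.ofReal_add (by positivity) (by positivity)]
        congr 1; linarith)
  rw [Metric.mem_closedBall, Real.dist_eq] at hy2 hy4
  have hxx : |x - x'| = r := by rw [abs_sub_comm, abs_of_pos hr0]
  calc |φ x - φ x'| = |(φ y - φ x') - (φ y - φ x)| := by congr 1; ring
    _ ≤ |φ y - φ x'| + |φ y - φ x| := abs_sub _ _
    _ ≤ (n + 1) * |y - x'| + (n + 1) * |y - x| := by gcongr
    _ ≤ (n + 1) * r + (n + 1) * r := by gcongr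
    _ = _ := by rw [hxx]; ring

theorem exists_lipschitzWith_eqOn_slopeSet {φ : ℝ → ℝ} {A : Set ℝ} (hA : MeasurableSet A)
    (hφ : AEMeasurable φ (volume.restrict A)) (n : ℕ) (p : ℤ) :
    ∃ (C : NNReal) (F : ℝ → ℝ), LipschitzWith C F ∧
      EqOn φ F (slopeSet φ A n ∩ {x | ⌊x * (n + 1)⌋ = p}) := by
  -- Points with the same floor are closer than `1 / (n + 1)`, the range of scales that `slopeSet`
  -- controls.
  have hL : LipschitzOnWith (2 * (n + 1)) φ (slopeSet φ A n ∩ {x | ⌊x * (n + 1)⌋ = p}) := by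
    have aux : ∀ x ∈ slopeSet φ A n ∩ {x | ⌊x * (n + 1)⌋ = p},
        ∀ x' ∈ slopeSet φ A n ∩ {x | ⌊x * (n + 1)⌋ = p}, x < x' →
        |φ x - φ x'| ≤ 2 * (n + 1) * |x - x'| := by
      rintro x ⟨hx, hxp⟩ x' ⟨hx', hxp'⟩ hlt
      refine dist_le_of_mem_slopeSet hA hφ hx hx' hlt ?_
      rw [mem_ofPred_eq, Int.floor_eq_iff] at hxp hxp'
      rw [lt_div_iff₀ (by positivity)]
      linarith
    refine LipschitzOnWith.of_dist_le_mul fun x hx x' hx' => ?_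
    rw [Real.dist_eq, Real.dist_eq]
    push_cast
    rcases lt_trichotomy x x' with h | rfl | h
    · exact aux x hx x' hx' h
    · simp
    · rw [abs_sub_comm, abs_sub_comm x x']
      exact aux x' hx' x hx h
  obtain ⟨F, hF, hE⟩ := hL.extend_real
  exact ⟨_, F, hF, hE⟩

/-- Passing to the coincidence sets `{φ = F i}` makes measurability of `slopeSet` irrelevant. -/
theorem exists_countable_lipschitz_cover {φ : ℝ → ℝ} {A : Set ℝ} (hA : MeasurableSet A)
    (hφ : AEMeasurable φ (volume.restrict A)) :
    ∃ F : ℕ × ℤ → ℝ → ℝ, (∀ i, ∃ C, LipschitzWith C (F i)) ∧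
      ∀ x l, HasApproxDerivWithinAt φ l A x → ∃ i, φ x = F i x := by
  choose C F hF hE using exists_lipschitzWith_eqOn_slopeSet hA hφ
  refine ⟨fun i => F i.1 i.2, fun i => ⟨_, hF i.1 i.2⟩, fun x l h => ?_⟩
  obtain ⟨n, hn⟩ := h.exists_mem_slopeSet
  exact ⟨(n, ⌊x * (n + 1)⌋), hE n _ ⟨hn, rfl⟩⟩

/-- Almost every point of the coincidence set is a density point of it (Lebesgue) and a
differentiability point of `F` (Rademacher). At such points the approximate derivative is a genuine
derivative within the set. -/
theorem exists_measurableSet_hasDerivWithinAt_of_lipschitz {φ φ' F : ℝ → ℝ} {A : Set ℝ}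
    {C : NNReal} (hA : MeasurableSet A) (hφ : AEMeasurable φ (volume.restrict A))
    (hF : LipschitzWith C F)
    (h : ∀ᵐ x ∂volume.restrict A, HasApproxDerivWithinAt φ (φ' x) A x)
    (hne : ∀ᵐ x ∂volume.restrict A, φ' x ≠ 0) :
    ∃ V ⊆ A, MeasurableSet V ∧ volume ({x ∈ A | φ x = F x} \ V) = 0 ∧
      ∀ x ∈ V, HasDerivWithinAt φ (φ' x) V x ∧ φ' x ≠ 0 := by
  have hS : NullMeasurableSet {x ∈ A | φ x = F x} volume := by
    have h3 : NullMeasurableSet {x | φ x = F x} (volume.restrict A) :=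
      nullMeasurableSet_eq_fun hφ hF.continuous.measurable.aemeasurable
    have := (nullMeasurableSet_restrict hA.nullMeasurableSet).1 h3
    rwa [inter_comm] at this
  obtain ⟨S, hSs, hSm, hSe⟩ := hS.exists_measurable_subset_ae_eq
  set W := {x ∈ S | IsDensityPoint S x ∧ DifferentiableAt ℝ F x ∧
    HasApproxDerivWithinAt φ (φ' x) A x ∧ φ' x ≠ 0} with hW
  have hWS : W =ᵐ[volume] S := by
    rw [ae_restrict_iff' hA] at h hne
    have hd := Besicovitch.ae_tendsto_measure_inter_div_of_measurableSet volume hSm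
    filter_upwards [h, hne, hd, hF.ae_differentiableAt_real] with x h1 h2 h3 h4
    refine propext ⟨fun hx => hx.1, fun hx => ?_⟩
    have hx : x ∈ S := hx
    have hxA := (hSs hx).1
    refine ⟨hx, ?_, h4, h1 hxA, h2 hxA⟩
    rwa [indicator_of_mem hx] at h3
  have hWn : NullMeasurableSet W volume := hSm.nullMeasurableSet.congr hWS.symm
  obtain ⟨V, hVW, hVm, hVe⟩ := hWn.exists_measurable_subset_ae_eq
  refine ⟨V, fun x hx => (hSs (hVW hx).1).1, hVm, ?_, fun x hx => ?_⟩
  · exact ae_le_set.1 (hSe.symm.trans (hWS.symm.trans hVe.symm)).le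
  · obtain ⟨hxS, hxd, hxF, hxφ, hx0⟩ := hVW hx
    have heq : EqOn φ F S := fun y hy => (hSs hy).2
    have := hxφ.eq_of_hasDerivAt hxF.hasDerivAt hxd hSm heq hxS
    refine ⟨?_, hx0⟩
    rw [this]
    exact hxF.hasDerivAt.hasDerivWithinAt.congr (fun y hy => heq (hVW hy).1) (heq hxS)

theorem exists_partition_injOn_of_hasDerivWithinAt {φ φ' : ℝ → ℝ} {V : Set ℝ}
    (h : ∀ x ∈ V, HasDerivWithinAt φ (φ' x) V x) (hne : ∀ x ∈ V, φ' x ≠ 0) :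
    ∃ t : ℕ → Set ℝ, (∀ n, MeasurableSet (t n)) ∧ V ⊆ ⋃ n, t n ∧
      ∀ n, InjOn φ (V ∩ t n) := by
  classical
  obtain ⟨t, B, -, htm, hcov, happ, hB⟩ :=
    exists_partition_approximatesLinearOn_of_hasFDerivWithinAt φ V
      (fun x => ContinuousLinearMap.toSpanSingleton ℝ (φ' x))
      (fun x hx => (h x hx).hasFDerivWithinAt)
      (fun B => if B = 0 then 1 else ‖B 1‖₊ / 2) (by
        intro B
        split_ifs with hB
        · exact one_ne_zero
        · have : B 1 ≠ 0 := fun h0 => hB (ContinuousLinearMap.ext_ring (by simpa using h0))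
          simpa using this)
  refine ⟨t, htm, hcov, fun n x hx y hy hxy => ?_⟩
  obtain ⟨z, hz, hBz⟩ := hB ⟨x, hx.1⟩ n
  have hB1 : B n 1 = φ' z := by rw [hBz]; simp
  have hB1' : B n 1 ≠ 0 := by rw [hB1]; exact hne z hz
  have hB0 : B n ≠ 0 := fun h0 => hB1' (by rw [h0]; rfl)
  have h1 := (happ n) x hx y hy
  have h2 : B n (x - y) = (x - y) * B n 1 := by
    rw [← smul_eq_mul, ← (B n).map_smul]; simp
  rw [hxy, sub_self, zero_sub, norm_neg, h2, norm_mul, if_neg hB0] at h1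
  push_cast at h1
  have h3 : 0 < ‖B n 1‖ := norm_pos_iff.2 hB1'
  have h4 : ‖x - y‖ ≤ 0 := by nlinarith [norm_nonneg (x - y)]
  exact sub_eq_zero.1 (norm_le_zero_iff.1 h4)

/-- A function with a nonzero approximate derivative almost everywhere decomposes, up to a null
set, into countably many disjoint measurable pieces on which it is injective and differentiable. -/
theorem exists_disjoint_injOn_hasDerivWithinAt {φ φ' : ℝ → ℝ} {A : Set ℝ}
    (hA : MeasurableSet A) (hφ : AEMeasurable φ (volume.restrict A))
    (h : ∀ᵐ x ∂volume.restrict A, HasApproxDerivWithinAt φ (φ' x) A x)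
    (hne : ∀ᵐ x ∂volume.restrict A, φ' x ≠ 0) :
    ∃ T : ℕ → Set ℝ, (∀ i, MeasurableSet (T i)) ∧ Pairwise (Function.onFun Disjoint T) ∧
      (∀ i, T i ⊆ A) ∧ volume (A \ ⋃ i, T i) = 0 ∧
      (∀ i, ∀ x ∈ T i, HasDerivWithinAt φ (φ' x) (T i) x) ∧ ∀ i, InjOn φ (T i) := by
  obtain ⟨F, hF, hcov⟩ := exists_countable_lipschitz_cover hA hφ
  choose C hF using hF
  choose V hVA hVm hV0 hVd using fun i =>
    exists_measurableSet_hasDerivWithinAt_of_lipschitz hA hφ (hF i) h hne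
  choose t htm hVt hinj using fun i =>
    exists_partition_injOn_of_hasDerivWithinAt (fun x hx => (hVd i x hx).1)
      (fun x hx => (hVd i x hx).2)
  obtain ⟨e, he⟩ := exists_surjective_nat ((ℕ × ℤ) × ℕ)
  set U : ℕ → Set ℝ := fun k => V (e k).1 ∩ t (e k).1 (e k).2 with hU
  have hsub : ∀ k, disjointed U k ⊆ U k := disjointed_subset U
  refine ⟨disjointed U, fun i => MeasurableSet.disjointed
    (fun k => (hVm _).inter (htm _ _)) i, disjoint_disjointed U,
    fun i x hx => hVA _ (hsub i hx).1, ?_, fun i x hx => ?_, fun i => (hinj _ _).mono (hsub i)⟩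
  · have hnull : volume {x | ¬ (x ∈ A → HasApproxDerivWithinAt φ (φ' x) A x)} = 0 :=
      ae_iff.1 ((ae_restrict_iff' hA).1 h)
    refine measure_mono_null (t := {x | ¬ (x ∈ A → HasApproxDerivWithinAt φ (φ' x) A x)} ∪
      ⋃ i, ({x ∈ A | φ x = F i x} \ V i)) ?_
      (measure_union_null hnull (measure_iUnion_null hV0))
    rintro x ⟨hxA, hx⟩
    by_cases hxd : HasApproxDerivWithinAt φ (φ' x) A x
    · right
      obtain ⟨i, hi⟩ := hcov x _ hxd
      refine mem_iUnion.2 ⟨i, ⟨hxA, hi⟩, fun hxV => hx ?_⟩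
      obtain ⟨n, hn⟩ := mem_iUnion.1 (hVt i hxV)
      obtain ⟨k, hk⟩ := he (i, n)
      rw [iUnion_disjointed]
      refine mem_iUnion.2 ⟨k, ?_⟩
      simp only [hU, hk]
      exact ⟨hxV, hn⟩
    · left
      exact fun hc => hxd (hc hxA)
  · exact ((hVd _ x (hsub i hx).1).1).mono ((hsub i).trans inter_subset_left)

/-! ### The area inequality on the line -/

/-- The area inequality for maps of bounded multiplicity. -/
theorem lintegral_abs_mul_comp_le {φ φ' : ℝ → ℝ} {A : Set ℝ} {K : ℕ}
    (hA : MeasurableSet A) (hφ : AEMeasurable φ (volume.restrict A))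
    (h : ∀ᵐ x ∂volume.restrict A, HasApproxDerivWithinAt φ (φ' x) A x)
    (hne : ∀ᵐ x ∂volume.restrict A, φ' x ≠ 0)
    (hN : ∀ Z ⊆ A, volume Z = 0 → volume (φ '' Z) = 0)
    (hK : ∀ᵐ y ∂volume.restrict (φ '' A), {x ∈ A | φ x = y}.encard ≤ K) :
    NullMeasurableSet (φ '' A) volume ∧
    (∀ w : ℝ → ℝ≥0∞, AEMeasurable w (volume.restrict (φ '' A)) →
      ∫⁻ x in A, ENNReal.ofReal |φ' x| * w (φ x) ≤ K * ∫⁻ y in φ '' A, w y) ∧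
    AEMeasurable φ' (volume.restrict A) := by
  classical
  obtain ⟨T, hTm, hTd, hTA, hT0, hTder, hTinj⟩ :=
    exists_disjoint_injOn_hasDerivWithinAt hA hφ h hne
  have him : ∀ i, MeasurableSet (φ '' T i) := fun i =>
    measurable_image_of_fderivWithin (hTm i) (fun x hx => (hTder i x hx).hasFDerivWithinAt)
      (hTinj i)
  set R := ⋃ i, φ '' T i with hR
  have hRm : MeasurableSet R := MeasurableSet.iUnion him
  have hRsub : R ⊆ φ '' A := iUnion_subset fun i => image_mono (hTA i)
  -- What `R` misses is contained in the image of the null set left over by the pieces, which is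
  -- null by condition N.
  have hRae : R =ᵐ[volume] φ '' A := by
    refine hRsub.eventuallyLE.antisymm (ae_le_set.2 (measure_mono_null ?_
      (hN _ sdiff_subset hT0)))
    rintro y ⟨⟨x, hxA, rfl⟩, hx⟩
    refine ⟨x, ⟨hxA, fun hxT => hx ?_⟩, rfl⟩
    obtain ⟨i, hi⟩ := mem_iUnion.1 hxT
    exact mem_iUnion.2 ⟨i, x, hi, rfl⟩
  have hTae : (⋃ i, T i) =ᵐ[volume] A :=
    (iUnion_subset hTA).eventuallyLE.antisymm (ae_le_set.2 hT0)
  refine ⟨hRm.nullMeasurableSet.congr hRae, fun w hw => ?_, ?_⟩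
  · have hw' : ∀ i, AEMeasurable w (volume.restrict (φ '' T i)) := fun i =>
      hw.mono_measure (Measure.restrict_mono (image_mono (hTA i)) le_rfl)
    calc ∫⁻ x in A, ENNReal.ofReal |φ' x| * w (φ x)
        = ∑' i, ∫⁻ x in T i, ENNReal.ofReal |φ' x| * w (φ x) := by
          rw [← setLIntegral_congr hTae, lintegral_iUnion hTm hTd]
      _ = ∑' i, ∫⁻ y in φ '' T i, w y := by
          congr 1; ext i
          rw [lintegral_image_eq_lintegral_abs_deriv_mul (hTm i) (hTder i) (hTinj i)]
      _ = ∑' i, ∫⁻ y in φ '' A, (φ '' T i).indicator w y := by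
          congr 1; ext i
          rw [lintegral_indicator (him i), Measure.restrict_restrict (him i),
            inter_eq_self_of_subset_left (image_mono (hTA i))]
      _ = ∫⁻ y in φ '' A, ∑' i, (φ '' T i).indicator w y :=
          (lintegral_tsum fun i => hw.indicator (him i)).symm
      _ ≤ ∫⁻ y in φ '' A, K * w y := by
          refine lintegral_mono_ae ?_
          filter_upwards [hK] with y hy
          refine ENNReal.summable.tsum_le_of_sum_le fun s => ?_
          rw [Finset.sum_indicator_eq_sum_filter, Finset.sum_const, nsmul_eq_mul]
          gcongr
          -- One preimage of `y` per piece: disjointness of the pieces makes these distinct, so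
          -- their number is at most the size of the fibre.
          choose! x hx using fun i (hi : y ∈ φ '' T i) => hi
          have hinj : InjOn x (s.filter fun i => y ∈ φ '' T i : Finset ℕ) := by
            intro i hi j hj hij
            by_contra hne
            have hi' := (hx i (Finset.mem_filter.1 hi).2).1
            have hj' := (hx j (Finset.mem_filter.1 hj).2).1
            rw [← hij] at hj'
            exact disjoint_left.1 (hTd hne) hi' hj'
          have hle : ((s.filter fun i => y ∈ φ '' T i).card : ℕ∞) ≤ K := by
            rw [← Set.encard_coe_eq_coe_finsetCard, ← hinj.encard_image]
            refine (encard_le_encard ?_).trans hy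
            rintro _ ⟨i, hi, rfl⟩
            have := hx i (Finset.mem_filter.1 hi).2
            exact ⟨hTA i this.1, this.2⟩
          exact_mod_cast hle
      _ = K * ∫⁻ y in φ '' A, w y := lintegral_const_mul' _ _ (by simp)
  · rw [← Measure.restrict_congr_set hTae, aemeasurable_iUnion_iff]
    intro i
    have := aemeasurable_fderivWithin volume (hTm i)
      (fun x hx => (hTder i x hx).hasFDerivWithinAt)
    simpa using this.apply_continuousLinearMap 1

/-! ### Transfer to the unit interval -/

theorem measurePreserving_coe_unitInterval :
    MeasurePreserving (Subtype.val : I → ℝ) volume (volume.restrict I) :=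
  ⟨measurable_subtype_coe, map_comap_subtype_coe measurableSet_Icc volume⟩

theorem measurableEmbedding_coe_unitInterval : MeasurableEmbedding (Subtype.val : I → ℝ) :=
  MeasurableEmbedding.subtype_coe measurableSet_Icc

theorem hasApproxDerivWithinAt_IccExtend {h : I → ℝ} {l : ℝ} {x : I}
    (hl : HasApproxDerivAt h l x) :
    HasApproxDerivWithinAt (IccExtend zero_le_one h) l I x := by
  intro ε hε
  have := hl ε hε
  convert this using 1
  ext y
  constructor
  · rintro ⟨hy, hyx, h1⟩
    refine ⟨⟨y, hy⟩, ⟨fun h2 => hyx (congrArg Subtype.val h2), ?_⟩, rfl⟩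
    rwa [IccExtend_of_mem _ _ hy, IccExtend_of_mem _ _ x.2] at h1
  · rintro ⟨z, ⟨hzx, h1⟩, rfl⟩
    refine ⟨z.2, fun h2 => hzx (Subtype.ext h2), ?_⟩
    rw [IccExtend_of_mem _ _ z.2, IccExtend_of_mem _ _ x.2]
    exact h1

theorem ApproxDifferentiableAt.hasApproxDerivAt {E : Set ℝ} {h : E → ℝ} {x : E}
    (hx : ApproxDifferentiableAt h x) : HasApproxDerivAt h (approxDeriv h x) x := by
  rw [approxDeriv, dif_pos hx]
  exact hx.choose_spec

theorem aemeasurable_IccExtend {β : Type*} [MeasurableSpace β] {h : I → β}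
    (hh : AEMeasurable h volume) :
    AEMeasurable (IccExtend zero_le_one h) (volume.restrict I) := by
  rw [← measurePreserving_coe_unitInterval.map_eq,
    measurableEmbedding_coe_unitInterval.aemeasurable_map_iff]
  have : IccExtend zero_le_one h ∘ Subtype.val = h := funext fun x => IccExtend_val _ _ x
  rwa [this]

theorem ae_restrict_unitInterval_iff {p : ℝ → Prop} :
    (∀ᵐ x ∂volume.restrict I, p x) ↔ ∀ᵐ x : I, p x := by
  rw [← measurePreserving_coe_unitInterval.map_eq,
    measurableEmbedding_coe_unitInterval.ae_map_iff]

theorem area_inequality {f : I → I} {K : ℕ} (hf : AEMeasurable f volume)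
    (hd : ∀ᵐ x : I, ApproxDifferentiableAt (fun y : I => (f y : ℝ)) x) (hN : LuzinN f)
    (hK : volume {y : I | (K : ℕ∞) < (f ⁻¹' {y}).encard} = 0)
    (hne : ∀ᵐ x : I, approxDeriv (fun y : I => (f y : ℝ)) x ≠ 0) :
    NullMeasurableSet (range f) volume ∧
    (∀ w : I → ℝ≥0∞, AEMeasurable w volume →
      ∫⁻ x, ENNReal.ofReal |approxDeriv (fun y : I => (f y : ℝ)) x| * w (f x) ≤
        K * ∫⁻ y in range f, w y) ∧
    AEMeasurable (approxDeriv (fun y : I => (f y : ℝ))) volume := by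
  set h : I → ℝ := fun y => (f y : ℝ) with hh
  set φ := IccExtend zero_le_one h with hφ
  set φ' := IccExtend zero_le_one (approxDeriv h) with hφ'
  have hφv : ∀ x : I, φ x = f x := fun x => IccExtend_val _ _ x
  have hφv' : ∀ x : I, φ' x = approxDeriv h x := fun x => IccExtend_val _ _ x
  have him : φ '' I = Subtype.val '' range f := by
    ext y
    constructor
    · rintro ⟨x, hx, rfl⟩
      exact ⟨f ⟨x, hx⟩, mem_range_self _, (hφv ⟨x, hx⟩).symm⟩
    · rintro ⟨_, ⟨x, rfl⟩, rfl⟩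
      exact ⟨x, x.2, hφv x⟩
  have himI : φ '' I ⊆ I := by
    rw [him]; rintro _ ⟨y, -, rfl⟩; exact y.2
  obtain ⟨h1, h2, h3⟩ := lintegral_abs_mul_comp_le (φ := φ) (φ' := φ') (K := K)
    (measurableSet_Icc : MeasurableSet I)
    (aemeasurable_IccExtend (measurable_subtype_coe.comp_aemeasurable hf))
    (ae_restrict_unitInterval_iff.2 (by
      filter_upwards [hd] with x hx
      rw [hφv']
      exact hasApproxDerivWithinAt_IccExtend hx.hasApproxDerivAt))
    (ae_restrict_unitInterval_iff.2 (by
      filter_upwards [hne] with x hx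
      rwa [hφv']))
    (by
      intro Z hZ hZ0
      have hZ' : Z = Subtype.val '' (Subtype.val ⁻¹' Z : Set I) := by
        rw [Subtype.image_preimage_coe, inter_eq_self_of_subset_right hZ]
      have h4 : φ '' Z = Subtype.val '' (f '' (Subtype.val ⁻¹' Z : Set I)) := by
        conv_lhs => rw [hZ']
        rw [image_image, image_image]
        exact image_congr fun x _ => hφv x
      rw [h4, volume_image_subtype_coe measurableSet_Icc]
      refine hN _ ?_
      rwa [← volume_image_subtype_coe measurableSet_Icc, ← hZ'])
    (by
      refine ae_restrict_of_ae_restrict_of_subset himI (ae_restrict_unitInterval_iff.2 ?_)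
      filter_upwards [measure_eq_zero_iff_ae_notMem.1 hK] with y hy
      refine le_trans (le_of_eq ?_) (not_lt.1 hy)
      rw [← Subtype.val_injective.injOn.encard_image]
      congr 1
      ext x
      constructor
      · rintro ⟨hx, hxy⟩
        exact ⟨⟨x, hx⟩, Subtype.ext ((hφv ⟨x, hx⟩).symm.trans hxy), rfl⟩
      · rintro ⟨z, hz, rfl⟩
        exact ⟨z.2, (hφv z).trans (congrArg Subtype.val hz)⟩)
  refine ⟨?_, fun w hw => ?_, ?_⟩
  · have := h1.mono_ac (Measure.absolutelyContinuous_of_le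
      (Measure.restrict_le_self (s := I) (μ := volume)))
    rw [him] at this
    have h5 := this.preimage measurePreserving_coe_unitInterval.quasiMeasurePreserving
    rwa [preimage_image_eq _ Subtype.val_injective] at h5
  · have h4 := h2 (IccExtend zero_le_one w)
      ((aemeasurable_IccExtend hw).mono_measure (Measure.restrict_mono himI le_rfl))
    rw [← measurePreserving_coe_unitInterval.lintegral_comp_emb
      measurableEmbedding_coe_unitInterval] at h4
    have h5 : volume.restrict (φ '' I) = (volume.restrict I).restrict (φ '' I) := by
      rw [Measure.restrict_restrict₀' measurableSet_Icc.nullMeasurableSet,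
        inter_eq_self_of_subset_left himI]
    rw [h5, him, ← measurePreserving_coe_unitInterval.setLIntegral_comp_emb
      measurableEmbedding_coe_unitInterval] at h4
    simpa only [hφv, hφv', IccExtend_val] using h4
  · rw [← measurePreserving_coe_unitInterval.map_eq,
      measurableEmbedding_coe_unitInterval.aemeasurable_map_iff] at h3
    have : φ' ∘ Subtype.val = approxDeriv h := funext hφv'
    rwa [this] at h3

/-! ### Weighted composition with one map -/

/-- Luzin's condition N together with bounded multiplicity `K`, in the integrated form of the area
inequality `∫ |f'| (w ∘ f) ≤ K ∫ w` over the range of `f`. -/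
structure AreaBound (f : I → I) (D : I → ℝ) (K : ℕ) : Prop where
  pos : 0 < K
  aemeasurable : AEMeasurable f volume
  aemeasurable_deriv : AEMeasurable D volume
  ae_comp : ∀ p : I → Prop, (∀ᵐ y, p y) → ∀ᵐ x, p (f x)
  nullMeasurableSet_range : NullMeasurableSet (range f) volume
  lintegral_le : ∀ w : I → ℝ≥0∞, AEMeasurable w volume →
      ∫⁻ x, ENNReal.ofReal |D x| * w (f x) ≤ K * ∫⁻ y in range f, w y

namespace AreaBound

variable {f : I → I} {D g h : I → ℝ} {K : ℕ} {c : ℝ}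

theorem aemeasurable_comp (hf : AreaBound f D K) (hh : AEMeasurable h volume) :
    AEMeasurable (fun x => h (f x)) volume :=
  (hh.measurable_mk.comp_aemeasurable hf.aemeasurable).congr
    ((hf.ae_comp _ hh.ae_eq_mk).mono fun _ hx => hx.symm)

theorem lintegral_enorm_le (hf : AreaBound f D K) (hh : AEMeasurable h volume)
    (hc : 0 ≤ c) (hle : ∀ᵐ x, |g x| ≤ c / K * |D x|) :
    ∫⁻ x, ‖g x * h (f x)‖ₑ ≤ ENNReal.ofReal c * ∫⁻ y in range f, ‖h y‖ₑ := by
  have hK : (0 : ℝ) < K := Nat.cast_pos.2 hf.pos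
  calc ∫⁻ x, ‖g x * h (f x)‖ₑ
      ≤ ∫⁻ x, ENNReal.ofReal (c / K) * (ENNReal.ofReal |D x| * ‖h (f x)‖ₑ) := by
        refine lintegral_mono_ae ?_
        filter_upwards [hle] with x hx
        rw [enorm_mul, ← mul_assoc, ← ENNReal.ofReal_mul (by positivity), Real.enorm_eq_ofReal_abs]
        gcongr
    _ = ENNReal.ofReal (c / K) * ∫⁻ x, ENNReal.ofReal |D x| * ‖h (f x)‖ₑ :=
        lintegral_const_mul' _ _ ENNReal.ofReal_ne_top
    _ ≤ ENNReal.ofReal (c / K) * (K * ∫⁻ y in range f, ‖h y‖ₑ) := by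
        gcongr
        exact hf.lintegral_le _ hh.enorm
    _ = ENNReal.ofReal c * ∫⁻ y in range f, ‖h y‖ₑ := by
        rw [← mul_assoc, ← ENNReal.ofReal_natCast K, ← ENNReal.ofReal_mul (by positivity),
          div_mul_cancel₀ _ hK.ne']

theorem integrable_mul_comp (hf : AreaBound f D K) (hg : AEMeasurable g volume)
    (hh : Integrable h) (hc : 0 ≤ c) (hle : ∀ᵐ x, |g x| ≤ c / K * |D x|) :
    Integrable (fun x => g x * h (f x)) := by
  refine ⟨(hg.mul (hf.aemeasurable_comp hh.aemeasurable)).aestronglyMeasurable, ?_⟩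
  refine (hf.lintegral_enorm_le hh.aemeasurable hc hle).trans_lt ?_
  exact ENNReal.mul_lt_top ENNReal.ofReal_lt_top hh.restrict.2

theorem integral_abs_mul_comp_le (hf : AreaBound f D K) (hg : AEMeasurable g volume)
    (hh : Integrable h) (hc : 0 ≤ c) (hle : ∀ᵐ x, |g x| ≤ c / K * |D x|) :
    ∫ x, |g x * h (f x)| ≤ c * ∫ y in range f, |h y| := by
  have hi := hf.integrable_mul_comp hg hh hc hle
  have h1 := integral_norm_eq_lintegral_enorm hi.1
  have h2 := integral_norm_eq_lintegral_enorm (hh.restrict (s := range f)).1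
  simp only [Real.norm_eq_abs] at h1 h2
  rw [h1, h2]
  calc (∫⁻ x, ‖g x * h (f x)‖ₑ).toReal
      ≤ (ENNReal.ofReal c * ∫⁻ y in range f, ‖h y‖ₑ).toReal :=
        ENNReal.toReal_mono (ENNReal.mul_lt_top ENNReal.ofReal_lt_top hh.restrict.2).ne
          (hf.lintegral_enorm_le hh.aemeasurable hc hle)
    _ = c * (∫⁻ y in range f, ‖h y‖ₑ).toReal := by
        rw [ENNReal.toReal_mul, ENNReal.toReal_ofReal hc]

/-- If the weight is strictly smaller than allowed, equality in the integral bound forces the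
weighted composition to vanish. -/
theorem mul_comp_ae_eq_zero (hf : AreaBound f D K) (hg : AEMeasurable g volume)
    (hh : Integrable h) (hc : 0 ≤ c) (hlt : ∀ᵐ x, |g x| < c / K * |D x|)
    (heq : c * ∫ y in range f, |h y| ≤ ∫ x, |g x * h (f x)|) :
    ∀ᵐ x, g x * h (f x) = 0 := by
  have hc' : 0 ≤ c / K := by positivity
  -- The extremal weight `c / K * D` obeys the same integral bound, so its integral is squeezed
  -- between that of `g` and the bound itself. Equality then holds pointwise a.e., which the strict
  -- inequality permits only where `h ∘ f` vanishes.
  have hGm : AEMeasurable (fun x => c / K * D x) volume := hf.aemeasurable_deriv.const_mul _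
  have hG : ∀ᵐ x, |c / K * D x| ≤ c / K * |D x| :=
    Eventually.of_forall fun x => by rw [abs_mul, abs_of_nonneg hc']
  have hle : ∀ᵐ x, |g x| ≤ c / K * |D x| := hlt.mono fun _ hx => hx.le
  have hi := (hf.integrable_mul_comp hg hh hc hle).abs
  have hiG := (hf.integrable_mul_comp hGm hh hc hG).abs
  have hmono : (fun x => |g x * h (f x)|) ≤ᵐ[volume] fun x => |c / K * D x * h (f x)| := by
    filter_upwards [hle] with x hx
    rw [abs_mul, abs_mul, abs_mul (c / K), abs_of_nonneg hc']
    gcongr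
  have h1 : ∫ x, |g x * h (f x)| = ∫ x, |c / K * D x * h (f x)| :=
    le_antisymm (integral_mono_ae hi hiG hmono)
      ((hf.integral_abs_mul_comp_le hGm hh hc hG).trans heq)
  filter_upwards [(integral_eq_iff_of_ae_le hi hiG hmono).1 h1, hlt] with x hx hx'
  rw [abs_mul, abs_mul, abs_mul (c / K), abs_of_nonneg hc'] at hx
  have : (c / K * |D x| - |g x|) * |h (f x)| = 0 := by rw [sub_mul, hx, sub_self]
  rcases mul_eq_zero.1 this with h0 | h0
  · linarith
  · rw [abs_eq_zero.1 h0, mul_zero]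

end AreaBound

/-! ### Overlap of the ranges -/

/-- There are finitely many index sets, so those with null intersection can be discarded together.
-/
theorem ae_card_le_overlapNumber {N : ℕ} (f : Fin N → I → I) :
    ∀ᵐ y : I, ∀ S : Finset (Fin N), (∀ n ∈ S, y ∈ range (f n)) → S.card ≤ overlapNumber f := by
  have hbdd : BddAbove {m : ℕ | ∃ S : Finset (Fin N), S.Nonempty ∧ S.card = m ∧
      0 < volume (⋂ n ∈ S, range (f n))} := by
    refine ⟨N, ?_⟩
    rintro _ ⟨S, -, rfl, -⟩
    simpa using S.card_le_univ
  rw [ae_all_iff]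
  intro S
  rcases S.eq_empty_or_nonempty with rfl | hS
  · simp
  by_cases h0 : volume (⋂ n ∈ S, range (f n)) = 0
  · filter_upwards [measure_eq_zero_iff_ae_notMem.1 h0] with y hy hyS
    exact absurd (mem_iInter₂.2 hyS) hy
  · exact Eventually.of_forall fun y _ => le_csSup hbdd ⟨S, hS, rfl, pos_iff_ne_zero.2 h0⟩

theorem sum_setIntegral_abs_range_le {N : ℕ} {f : Fin N → I → I}
    (hf : ∀ n, NullMeasurableSet (range (f n)) volume) {h : I → ℝ} (hh : Integrable h) :
    ∑ n, ∫ y in range (f n), |h y| ≤ overlapNumber f * ∫ y, |h y| := by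
  classical
  calc ∑ n, ∫ y in range (f n), |h y|
      = ∑ n, ∫ y, (range (f n)).indicator (fun y => |h y|) y := by
        refine Finset.sum_congr rfl fun n _ => (integral_indicator₀ (hf n)).symm
    _ = ∫ y, ∑ n, (range (f n)).indicator (fun y => |h y|) y :=
        (integral_finsetSum _ fun n _ => hh.abs.indicator₀ (hf n)).symm
    _ ≤ ∫ y, overlapNumber f * |h y| := by
        refine integral_mono_ae (integrable_finsetSum _ fun n _ => hh.abs.indicator₀ (hf n))
          (hh.abs.const_mul _) ?_
        filter_upwards [ae_card_le_overlapNumber f] with y hy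
        rw [Finset.sum_indicator_eq_sum_filter, Finset.sum_const, nsmul_eq_mul]
        gcongr
        exact hy _ fun n hn => (Finset.mem_filter.1 hn).2
    _ = _ := integral_const_mul _ _

theorem overlapNumber_pos {N : ℕ} {f : Fin N → I → I} {n : Fin N}
    (hn : volume (range (f n)) ≠ 0) : 0 < overlapNumber f := by
  by_contra h0
  refine hn (measure_eq_zero_iff_ae_notMem.2 ?_)
  filter_upwards [ae_card_le_overlapNumber f] with y hy hyn
  have := hy {n} (by simpa using hyn)
  simp at this
  omega

/-! ### The operator and its norm estimates -/

/-- A system of maps with area bounds, together with admissible weights. -/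
structure WeightedSystem (N K : ℕ) (f : Fin N → I → I) (g D : Fin N → I → ℝ) : Prop where
  area : ∀ n, AreaBound (f n) (D n) K
  aemeasurable : ∀ n, AEMeasurable (g n) volume
  lt : ∀ n, ∀ᵐ x, |g n x| < 1 / (overlapNumber f : ℝ) / K * |D n x|

namespace WeightedSystem

variable {N K : ℕ} {f : Fin N → I → I} {g D : Fin N → I → ℝ}

theorem le (S : WeightedSystem N K f g D) (n : Fin N) :
    ∀ᵐ x, |g n x| ≤ 1 / (overlapNumber f : ℝ) / K * |D n x| :=
  (S.lt n).mono fun _ hx => hx.le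

theorem integrable_term (S : WeightedSystem N K f g D) {h : I → ℝ} (hh : Integrable h)
    (n : Fin N) : Integrable (fun x => g n x * h (f n x)) :=
  (S.area n).integrable_mul_comp (S.aemeasurable n) hh (by positivity) (S.le n)

theorem integrable (S : WeightedSystem N K f g D) {h : I → ℝ} (hh : Integrable h) :
    Integrable (fun x => ∑ n, g n x * h (f n x)) :=
  integrable_finsetSum _ fun n _ => S.integrable_term hh n

theorem integral_abs_sum_le_sum (S : WeightedSystem N K f g D) {h : I → ℝ} (hh : Integrable h) :
    ∫ x, |∑ n, g n x * h (f n x)| ≤ ∑ n, ∫ x, |g n x * h (f n x)| := by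
  rw [← integral_finsetSum _ fun n _ => (S.integrable_term hh n).abs]
  exact integral_mono (S.integrable hh).abs
    (integrable_finsetSum _ fun n _ => (S.integrable_term hh n).abs)
    fun x => Finset.abs_sum_le_sum_abs _ _

theorem inv_overlap_mul_sum_le (S : WeightedSystem N K f g D) {h : I → ℝ} (hh : Integrable h) :
    ∑ n, 1 / (overlapNumber f : ℝ) * ∫ y in range (f n), |h y| ≤ ∫ y, |h y| := by
  have hI : 0 ≤ ∫ y, |h y| := integral_nonneg fun _ => abs_nonneg _
  rw [← Finset.mul_sum]
  calc 1 / (overlapNumber f : ℝ) * ∑ n, ∫ y in range (f n), |h y|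
      ≤ 1 / (overlapNumber f : ℝ) * (overlapNumber f * ∫ y, |h y|) := by
        gcongr
        exact sum_setIntegral_abs_range_le (fun n => (S.area n).nullMeasurableSet_range) hh
    _ = (1 / (overlapNumber f : ℝ) * overlapNumber f) * ∫ y, |h y| := by ring
    _ ≤ 1 * ∫ y, |h y| := by
        gcongr
        -- The factor is 1, or 0 when the overlap number is 0, so no positivity is required.
        rw [one_div]
        exact inv_mul_le_one
    _ = _ := one_mul _

theorem integral_abs_sum_le (S : WeightedSystem N K f g D) {h : I → ℝ} (hh : Integrable h) :
    ∫ x, |∑ n, g n x * h (f n x)| ≤ ∫ y, |h y| :=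
  (S.integral_abs_sum_le_sum hh).trans <| (Finset.sum_le_sum fun n _ =>
    (S.area n).integral_abs_mul_comp_le (S.aemeasurable n) hh (by positivity) (S.le n)).trans
    (S.inv_overlap_mul_sum_le hh)

/-- Equality of the norms would give equality in the bound of every single term, and then every term
vanishes a.e. -/
theorem integral_abs_sum_lt (S : WeightedSystem N K f g D) {h : I → ℝ} (hh : Integrable h)
    (hpos : 0 < ∫ x, |∑ n, g n x * h (f n x)|) :
    ∫ x, |∑ n, g n x * h (f n x)| < ∫ y, |h y| := by
  refine lt_of_le_of_ne (S.integral_abs_sum_le hh) fun heq => hpos.ne' ?_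
  have hterm := fun n (_ : n ∈ (Finset.univ : Finset (Fin N))) =>
    (S.area n).integral_abs_mul_comp_le (S.aemeasurable n) hh (by positivity) (S.le n)
  have hsum := le_antisymm (Finset.sum_le_sum hterm)
    ((S.inv_overlap_mul_sum_le hh).trans (heq.symm.le.trans (S.integral_abs_sum_le_sum hh)))
  have hall := (Finset.sum_eq_sum_iff_of_le hterm).1 hsum
  have hz : ∀ᵐ x, ∀ n, g n x * h (f n x) = 0 := ae_all_iff.2 fun n =>
    (S.area n).mul_comp_ae_eq_zero (S.aemeasurable n) hh (by positivity) (S.lt n)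
      (hall n (Finset.mem_univ n)).ge
  refine integral_eq_zero_of_ae ?_
  filter_upwards [hz] with x hx
  simp [hx]

/-- The term `m` is estimated with `C / L` in place of `1 / L`; the difference is the gain on the
left. -/
theorem integral_abs_sum_add_le (S : WeightedSystem N K f g D) {h : I → ℝ} (hh : Integrable h)
    {m : Fin N} {C : ℝ} (hC : 0 ≤ C)
    (hm : ∀ᵐ x, |g m x| ≤ C / (overlapNumber f : ℝ) / K * |D m x|) :
    (∫ x, |∑ n, g n x * h (f n x)|) +
      (1 - C) / (overlapNumber f : ℝ) * ∫ y in range (f m), |h y| ≤ ∫ y, |h y| := by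
  classical
  refine le_trans ?_ (S.inv_overlap_mul_sum_le hh)
  have h1 := S.integral_abs_sum_le_sum hh
  rw [← Finset.add_sum_erase _ _ (Finset.mem_univ m)] at h1 ⊢
  have h2 := (S.area m).integral_abs_mul_comp_le (S.aemeasurable m) hh (by positivity) hm
  have h3 := Finset.sum_le_sum fun n (_ : n ∈ Finset.univ.erase m) =>
    (S.area n).integral_abs_mul_comp_le (S.aemeasurable n) hh (by positivity) (S.le n)
  have h4 : (1 - C) / (overlapNumber f : ℝ) * ∫ y in range (f m), |h y| =
      1 / (overlapNumber f : ℝ) * (∫ y in range (f m), |h y|) -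
      C / (overlapNumber f : ℝ) * ∫ y in range (f m), |h y| := by ring
  linarith

theorem exists_operator (S : WeightedSystem N K f g D) :
    ∃ P : L1I →L[ℝ] L1I,
      ∀ h : L1I, (P h : I → ℝ) =ᵐ[volume] fun x => ∑ n, g n x * h (f n x) := by
  have hint : ∀ h : L1I, Integrable (fun x => ∑ n, g n x * h (f n x)) := fun h =>
    S.integrable (L1.integrable_coeFn h)
  refine ⟨LinearMap.mkContinuous
    { toFun := fun h => (hint h).toL1 _
      map_add' := fun h₁ h₂ => ?_
      map_smul' := fun c h => ?_ } 1 fun h => ?_, fun h => (hint h).coeFn_toL1⟩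
  · rw [← Integrable.toL1_add, Integrable.toL1_eq_toL1_iff]
    -- Identities between representatives hold only a.e.; they survive composition with `f n`
    -- because preimages of null sets are null.
    filter_upwards [ae_all_iff.2 fun n => (S.area n).ae_comp _ (Lp.coeFn_add h₁ h₂)] with x hx
    simp only [Pi.add_apply] at hx ⊢
    rw [← Finset.sum_add_distrib]
    exact Finset.sum_congr rfl fun n _ => by rw [hx n, mul_add]
  · rw [RingHom.id_apply, ← Integrable.toL1_smul' _ (hint h), Integrable.toL1_eq_toL1_iff]
    filter_upwards [ae_all_iff.2 fun n => (S.area n).ae_comp _ (Lp.coeFn_smul c h)] with x hx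
    simp only [Pi.smul_apply, smul_eq_mul] at hx ⊢
    rw [Finset.mul_sum]
    exact Finset.sum_congr rfl fun n _ => by rw [hx n]; ring
  · rw [one_mul]
    change ‖(hint h).toL1 _‖ ≤ _
    rw [L1.norm_of_fun_eq_integral_norm, L1.norm_eq_integral_norm]
    exact S.integral_abs_sum_le (L1.integrable_coeFn h)

theorem norm_apply_eq {P : L1I →L[ℝ] L1I}
    (hP : ∀ h : L1I, (P h : I → ℝ) =ᵐ[volume] fun x => ∑ n, g n x * h (f n x)) (h : L1I) :
    ‖P h‖ = ∫ x, |∑ n, g n x * h (f n x)| := by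
  rw [L1.norm_eq_integral_norm]
  exact integral_congr_ae ((hP h).mono fun x hx => by simp only [hx, Real.norm_eq_abs])

end WeightedSystem

/-! ### Geometric decay and the main theorem -/

theorem exists_tendsto_sum_pow_apply {E : Type*} [NormedAddCommGroup E] [NormedSpace ℝ E]
    [CompleteSpace E] {P : E →L[ℝ] E} {u : E} {α : ℝ} (h0 : 0 ≤ α) (h1 : α < 1)
    (h : ∀ k : ℕ, ‖(P ^ k) u‖ ≤ α ^ k * ‖u‖) :
    ∃ φ : E, Tendsto (fun M : ℕ => ∑ k ∈ Finset.range M, (P ^ k) u) atTop (𝓝 φ) :=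
  ⟨_, (Summable.of_norm_bounded ((summable_geometric_of_lt_one h0 h1).mul_right ‖u‖)
    h).hasSum.tendsto_sum_nat⟩

theorem norm_pow_apply_le {E : Type*} [NormedAddCommGroup E] [NormedSpace ℝ E]
    {P : E →L[ℝ] E} {u : E} {α : ℝ} (h0 : 0 ≤ α)
    (h : ∀ k : ℕ, ‖(P ^ (k + 1)) u‖ ≤ α * ‖(P ^ k) u‖) (k : ℕ) :
    ‖(P ^ k) u‖ ≤ α ^ k * ‖u‖ := by
  induction k with
  | zero => simp
  | succ k ih =>
    calc ‖(P ^ (k + 1)) u‖ ≤ α * ‖(P ^ k) u‖ := h k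
      _ ≤ α * (α ^ k * ‖u‖) := by gcongr
      _ = α ^ (k + 1) * ‖u‖ := by ring

theorem areaBound_approxDeriv {f : I → I} {K : ℕ} (hK0 : 0 < K) (hf : NullMeasurable f volume)
    (hd : ∀ᵐ x : I, ApproxDifferentiableAt (fun y : I => (f y : ℝ)) x) (hN : LuzinN f)
    (hK : volume {y : I | (K : ℕ∞) < (f ⁻¹' {y}).encard} = 0)
    (hinv : ∀ A : Set ℝ, volume A = 0 → volume {x : I | (f x : ℝ) ∈ A} = 0)
    (hne : ∀ᵐ x : I, approxDeriv (fun y : I => (f y : ℝ)) x ≠ 0) :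
    AreaBound f (approxDeriv (fun y : I => (f y : ℝ))) K := by
  obtain ⟨h1, h2, h3⟩ := area_inequality hf.aemeasurable hd hN hK hne
  refine ⟨hK0, hf.aemeasurable, h3, fun p hp => ?_, h1, h2⟩
  rw [ae_iff] at hp ⊢
  have := hinv (Subtype.val '' {y | ¬ p y})
    (by rwa [volume_image_subtype_coe measurableSet_Icc])
  simpa [Subtype.val_injective.mem_set_image] using this

theorem mainTheorem3 (N K : ℕ) (hK : 0 < K)
    (f : Fin N → I → I) (g : Fin N → I → ℝ)
    (hf : ∀ n, NullMeasurable (f n) volume)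
    (hg : ∀ n, NullMeasurable (g n) volume)
    (H1 : ∀ n, (∀ᵐ x : I, ApproxDifferentiableAt (fun y : I => (f n y : ℝ)) x) ∧ LuzinN (f n))
    (H2 : ∀ n, volume {y : I | (K : ℕ∞) < (f n ⁻¹' {y}).encard} = 0)
    (H3 : ∀ n, ∀ A : Set ℝ, volume A = 0 → volume {x : I | (f n x : ℝ) ∈ A} = 0)
    (hC1 : ∀ n, ∀ᵐ x : I,
      |g n x| < 1 / ((K : ℝ) * (overlapNumber f : ℝ)) *
        |approxDeriv (fun y : I => (f n y : ℝ)) x|) :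
    ∃ P : L1I →L[ℝ] L1I,
      (∀ h : L1I, (P h : I → ℝ) =ᵐ[volume] fun x => ∑ n, g n x * h (f n x)) ∧
      ∀ u : L1I,
        (∀ k : ℕ+, 0 < ‖(P ^ (k : ℕ)) u‖) →
        ∀ (m : Fin N) (C : ℝ), C < 1 →
          (∀ᵐ x : I,
            |g m x| ≤ C / ((K : ℝ) * (overlapNumber f : ℝ)) *
              |approxDeriv (fun y : I => (f m y : ℝ)) x|) →
          0 < (⨅ k : ℕ+, 1 / ‖(P ^ (k : ℕ)) u‖ *
            ∫ x in range (f m), |((P ^ (k : ℕ)) u : L1I) x|) →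
          (∃ α : ℝ, 0 < α ∧ α < 1 ∧ ∀ k : ℕ, ‖(P ^ k) u‖ ≤ α ^ k * ‖u‖) ∧
          ∃ φ₀ : L1I, IsElementarySolution P u φ₀ := by
  have hdiv : ∀ c : ℝ, c / (overlapNumber f : ℝ) / K = c / ((K : ℝ) * (overlapNumber f : ℝ)) :=
    fun c => by rw [div_div, mul_comm]
  have S : WeightedSystem N K f g (fun n => approxDeriv (fun y : I => (f n y : ℝ))) := by
    refine ⟨fun n => areaBound_approxDeriv hK (hf n) (H1 n).1 (H1 n).2 (H2 n) (H3 n) ?_,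
      fun n => (hg n).aemeasurable, fun n => by simpa only [hdiv] using hC1 n⟩
    -- The strict bound on `|g n x|` rules out a zero approximate derivative.
    filter_upwards [hC1 n] with x hx h0
    rw [h0, abs_zero, mul_zero] at hx
    exact (abs_nonneg _).not_gt hx
  obtain ⟨P, hP⟩ := S.exists_operator
  refine ⟨P, hP, fun u hu m C hC hm hinf => ?_⟩
  -- The preimage of `range (f m)` under `f m` is the whole interval, so by (H3) the range is not
  -- null.
  have hL : (0 : ℝ) < overlapNumber f := by
    refine Nat.cast_pos.2 (overlapNumber_pos (n := m) fun h0 => ?_)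
    have h1 := (S.area m).ae_comp _ (measure_eq_zero_iff_ae_notMem.1 h0)
    obtain ⟨x, hx⟩ := h1.exists
    exact hx (mem_range_self x)
  set δ := ⨅ k : ℕ+, 1 / ‖(P ^ (k : ℕ)) u‖ *
    ∫ x in range (f m), |((P ^ (k : ℕ)) u : L1I) x| with hδ
  have hδle : ∀ k : ℕ+, δ * ‖(P ^ (k : ℕ)) u‖ ≤
      ∫ x in range (f m), |((P ^ (k : ℕ)) u : L1I) x| := fun k => by
    rw [← le_div_iff₀ (hu k), div_eq_inv_mul, ← one_div]
    refine ciInf_le ⟨0, ?_⟩ k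
    rintro _ ⟨j, rfl⟩
    exact mul_nonneg (by positivity) (integral_nonneg fun _ => abs_nonneg _)
  -- `C` may be negative, while the integral bounds need a nonnegative constant.
  set C' := max C 0 with hC'
  have hC'1 : C' < 1 := max_lt hC one_pos
  have hm' : ∀ᵐ x, |g m x| ≤ C' / (overlapNumber f : ℝ) / K *
      |approxDeriv (fun y : I => (f m y : ℝ)) x| := by
    filter_upwards [hm] with x hx
    rw [hdiv]
    refine hx.trans ?_
    gcongr
    exact le_max_left _ _
  set κ := (1 - C') / (overlapNumber f : ℝ) with hκ
  have hκ0 : 0 < κ := div_pos (by linarith) hL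
  have hstep : ∀ k : ℕ+, ‖(P ^ ((k : ℕ) + 1)) u‖ ≤ (1 - κ * δ) * ‖(P ^ (k : ℕ)) u‖ := fun k => by
    have h1 := S.integral_abs_sum_add_le (L1.integrable_coeFn ((P ^ (k : ℕ)) u))
      (le_max_right C 0) hm'
    rw [← WeightedSystem.norm_apply_eq hP] at h1
    have h2 : ‖(P ^ (k : ℕ)) u‖ = ∫ y, |((P ^ (k : ℕ)) u : L1I) y| :=
      L1.norm_eq_integral_norm _
    have h3 := mul_le_mul_of_nonneg_left (hδle k) hκ0.le
    rw [pow_succ', mul_apply_eq_comp]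
    linarith
  have hPu : 0 < ‖P u‖ := by simpa using hu 1
  have hlt : ‖P u‖ < ‖u‖ := by
    rw [WeightedSystem.norm_apply_eq hP] at hPu ⊢
    rw [L1.norm_eq_integral_norm u]
    exact S.integral_abs_sum_lt (L1.integrable_coeFn u) hPu
  have hu0 : 0 < ‖u‖ := hPu.trans hlt
  -- The infimum `δ` says nothing about `k = 0`, so the first ratio enters separately; being
  -- positive, it also keeps `α` positive.
  set α := max (‖P u‖ / ‖u‖) (1 - κ * δ) with hα
  have hα0 : 0 < α := lt_max_of_lt_left (div_pos hPu hu0)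
  have hα1 : α < 1 := max_lt ((div_lt_one hu0).2 hlt) (by linarith [mul_pos hκ0 hinf])
  have hbound := norm_pow_apply_le (P := P) (u := u) hα0.le fun k => by
    rcases Nat.eq_zero_or_pos k with rfl | hk
    · have : ‖P u‖ ≤ α * ‖u‖ := (div_le_iff₀ hu0).1 (le_max_left _ _)
      simpa using this
    · exact (hstep ⟨k, hk⟩).trans
        (mul_le_mul_of_nonneg_right (le_max_right _ _) (norm_nonneg _))
  exact ⟨⟨α, hα0, hα1, hbound⟩, exists_tendsto_sum_pow_apply hα0.le hα1 hbound⟩
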